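/- For integers $a,b$ let $$\mathrm{Li}_{a,b}(z)=\sum_{0<m_1<m_2}\frac{z^{m_2}}{m_1^{a}\,m_2^{b}}\qquad(|z|<1)$$ be the double polylogarithm, where $m_1,m_2$ run over integers; the same notation is used for its analytic continuation to $\mathbb{C}\setminus[1,\infty)$. The multi-poly-Bernoulli numbers $B_m^{(a,b)}$ $(m\ge 0)$ are defined by $$\frac{\mathrm{Li}_{a,b}(1-e^{-t})}{1-e^{-t}}=\sum_{m=0}^{\infty}B_m^{(a,b)}\frac{t^m}{m!}$$ for $t$ near $0$. **Theorem.** Let $k\ge 1$ and $n\ge 0$ be integers. Then $\mathrm{Li}_{k,-n}$ has an analytic continuation to $\mathbb{C}\setminus[1,\infty)$, and the displayed expansion with $(a,b)=(k,-n)$ holds for all sufficiently small $t\neq 0$, where $B_m^{(k,-n)}$ is the $m$-th derivative at $t=0$ of its left-hand side (extended by the value $0$ at $t=0$). The integral in $$\eta(k,-n;s)=\frac{1}{\Gamma(s)}\int_0^\infty t^{s-1}\,\frac{\mathrm{Li}_{k,-n}(1-e^{t})}{1-e^{t}}\,dt$$ converges absolutely for every $s\in\mathbb{C}$ with $\Re(s)>0$,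 and the function $\eta(k,-n;s)$ so defined for $\Re(s)>0$ extends to an entire function of $s$. The values of the extended function at the nonpositive integers are $$\eta(k,-n;-m)=B_m^{(k,-n)}\qquad(m\in\mathbb{Z}_{\ge 0}).$$ -/

import Mathlib

open Filter Topology

noncomputable section

/-- The plane cut along `[1, ∞)`, on which polylogarithms have their principal branch. -/
def polylogDomain : Set ℂ := {z | 1 - z ∈ Complex.slitPlane}

/-- The pairs `(m₁, m₂)` of integers with `0 < m₁ < m₂`. -/
def PolylogIndex : Type := {p : ℕ × ℕ // 0 < p.1 ∧ p.1 < p.2}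

/-- The term `z ^ m₂ / (m₁ ^ a * m₂ ^ b)` of the series of the double polylogarithm. -/
def doublePolylogTerm (a b : ℤ) (z : ℂ) (p : PolylogIndex) : ℂ :=
  z ^ p.1.2 / ((p.1.1 : ℂ) ^ a * (p.1.2 : ℂ) ^ b)

/-- `f` is holomorphic on `ℂ ∖ [1, ∞)`, and in the open unit disc it is the sum of the
(unconditionally convergent) series `∑_{0 < m₁ < m₂} z ^ m₂ / (m₁ ^ a * m₂ ^ b)`. -/
def IsDoublePolylog (a b : ℤ) (f : ℂ → ℂ) : Prop :=
  DifferentiableOn ℂ f polylogDomain ∧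
    ∀ z : ℂ, ‖z‖ < 1 → HasSum (doublePolylogTerm a b z) (f z)

/-- The continuation is unique on `ℂ ∖ [1, ∞)`. -/
theorem IsDoublePolylog.eqOn {a b : ℤ} {f g : ℂ → ℂ}
    (hf : IsDoublePolylog a b f) (hg : IsDoublePolylog a b g) :
    Set.EqOn f g polylogDomain := by
  have hopen : IsOpen polylogDomain :=
    Complex.isOpen_slitPlane.preimage (continuous_const.sub continuous_id)
  have h0 : (0 : ℂ) ∈ polylogDomain := by simp [polylogDomain]
  have hconn : IsPreconnected polylogDomain := by
    have h := (Complex.starConvex_one_slitPlane.isPathConnected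
      Complex.one_mem_slitPlane).isConnected.isPreconnected
    have h2 := h.image (fun z : ℂ => 1 - z) (by fun_prop)
    convert h2 using 1
    ext z
    constructor
    · intro hz
      exact ⟨1 - z, hz, by ring⟩
    · rintro ⟨w, hw, rfl⟩
      simpa [polylogDomain] using hw
  refine (hf.1.analyticOnNhd hopen).eqOn_of_preconnected_of_eventuallyEq
    (hg.1.analyticOnNhd hopen) hconn h0 ?_
  filter_upwards [Metric.ball_mem_nhds (0 : ℂ) one_pos] with z hz
  have hz' : ‖z‖ < 1 := by simpa using hz
  exact (hf.2 z hz').unique (hg.2 z hz')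

/-- The double polylogarithm `Li_{a,b}`, analytically continued to `ℂ ∖ [1, ∞)`. Off that
domain the value is arbitrary and never used. -/
def doublePolylog (a b : ℤ) : ℂ → ℂ :=
  Classical.epsilon (IsDoublePolylog a b)

/-- The generating function `t ↦ Li_{a,b}(1 - e^{-t}) / (1 - e^{-t})`. Since the series of
`Li_{a,b}(z)` starts at `z ^ 2`, the singularity at `t = 0` is removable with value `0`, which is
also the value of the quotient `0 / 0` here. -/
def polyBernoulliGen (a b : ℤ) (t : ℂ) : ℂ :=
  doublePolylog a b (1 - Complex.exp (-t)) / (1 - Complex.exp (-t))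

/-- The multi-poly-Bernoulli number `B_m^{(a,b)}`: `m!` times the coefficient of `t ^ m` in the
Taylor series of the generating function at `0`. -/
def multiPolyBernoulli (a b : ℤ) (m : ℕ) : ℂ :=
  iteratedDeriv m (polyBernoulliGen a b) 0

/-- The function `t ↦ Li_{a,b}(1 - e^t) / (1 - e^t)` of a real variable `t > 0`. -/
def etaKernel (a b : ℤ) (t : ℝ) : ℂ :=
  doublePolylog a b (1 - Complex.exp (t : ℂ)) / (1 - Complex.exp (t : ℂ))

/-- `η(a,b;s) = (1 / Γ(s)) ∫_0^∞ t ^ (s - 1) Li_{a,b}(1 - e^t) / (1 - e^t) dt`, meant for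
`Re s > 0`. -/
def etaFunction (a b : ℤ) (s : ℂ) : ℂ :=
  1 / Complex.Gamma s *
    ∫ t : ℝ in Set.Ioi 0, (t : ℂ) ^ (s - 1) * etaKernel a b t

end

/-! ### The quotient `Li_k(z) / z` on the cut plane. -/

noncomputable section

/-! Put `g_n(z) = Li_{k,-n}(z) / z` and `h_n(t) = g_n(1 - e^t)`, the kernel of `η`; the generating
function is `h_n(-t)`, so `B_m = (-1)^m h_n^{(m)}(0)`. For `n = 0` the sum over `m₂` is geometric
and `g_0 = Li_k(z) / (1 - z)`, where `Li_k(z) / z` is continued by iterated averages over the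
segments `[0, z]`. Raising `n` applies `z d/dz` to `Li_{k,-n}`, which in the variable `t` reads
`h_{n+1} = h_n + (1 - e^{-t}) h_n'` (`etaKernelExtension_succ`).

The functions that are holomorphic and `O(e^{-Re t/2})` in a half-strip around `[0, ∞)` are stable
under this recursion, by Cauchy's estimate, and contain `h_0` by `exists_norm_polylogQuotient_le`.
For such `h`, `N` integrations by parts continue `Γ(s)⁻¹ ∫ t^{s-1} h` to `Re s > -N`; at `s = -m`
with `N = m + 1` the integral becomes that of `h^{(m+1)}` and gives `(-1)^m h^{(m)}(0)`. -/

theorem isOpen_polylogDomain : IsOpen polylogDomain :=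
  Complex.isOpen_slitPlane.preimage (continuous_const.sub continuous_id)

theorem ofReal_mul_mem_polylogDomain {z : ℂ} (hz : z ∈ polylogDomain) {u : ℝ}
    (hu : u ∈ Set.Icc (0 : ℝ) 1) : (u : ℂ) * z ∈ polylogDomain := by
  have h := Complex.starConvex_one_slitPlane hz (sub_nonneg.2 hu.2) hu.1 (by ring)
  have e : 1 - (u : ℂ) * z = (1 - u) • (1 : ℂ) + u • (1 - z) := by
    simp only [Complex.real_smul]; push_cast; ring
  change 1 - (u : ℂ) * z ∈ Complex.slitPlane
  rw [e]; exact h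

theorem one_sub_ne_zero_of_mem_polylogDomain {z : ℂ} (hz : z ∈ polylogDomain) : 1 - z ≠ 0 :=
  Complex.slitPlane_ne_zero hz

theorem mem_polylogDomain_of_norm_lt_one {z : ℂ} (hz : ‖z‖ < 1) : z ∈ polylogDomain := by
  refine Or.inl ?_
  have := Complex.re_le_norm z
  simp only [Complex.sub_re, Complex.one_re]
  linarith

/-- On an open set that is star-shaped about `0`, the average of a holomorphic function over the
segments `[0, z]` is holomorphic. -/
theorem DifferentiableOn.integral_comp_ofReal_mul {f : ℂ → ℂ} {D : Set ℂ} (hD : IsOpen D)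
    (hstar : ∀ z ∈ D, ∀ u ∈ Set.Icc (0 : ℝ) 1, (u : ℂ) * z ∈ D) (hf : DifferentiableOn ℂ f D) :
    DifferentiableOn ℂ (fun z => ∫ u in (0 : ℝ)..1, f (u * z)) D := by
  intro z₀ hz₀
  obtain ⟨ε, hε, hball⟩ := Metric.nhds_basis_closedBall.mem_iff.1 (hD.mem_nhds hz₀)
  have hmaps : Set.MapsTo (fun p : ℝ × ℂ => (p.1 : ℂ) * p.2)
      (Set.Icc (0 : ℝ) 1 ×ˢ Metric.closedBall z₀ ε) D :=
    fun p hp => hstar _ (hball hp.2) _ hp.1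
  have hd : ContinuousOn (_root_.deriv f) D := (hf.deriv hD).continuousOn
  -- Compactness of the family of segments gives the uniform bound on `f'` that allows
  -- differentiation under the integral sign.
  obtain ⟨C, hC⟩ := ((isCompact_Icc.prod (isCompact_closedBall z₀ ε)).exists_bound_of_continuousOn
    (hd.comp (by fun_prop) hmaps))
  have hsegment : ∀ z ∈ D, ∀ g : ℂ → ℂ, ContinuousOn g D →
      IntervalIntegrable (fun u : ℝ => g (u * z)) MeasureTheory.volume 0 1 := by
    intro z hz g hg
    refine ContinuousOn.intervalIntegrable (hg.comp (by fun_prop) fun u hu => ?_)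
    rw [Set.uIcc_of_le zero_le_one] at hu
    exact hstar z hz u hu
  have key := intervalIntegral.hasDerivAt_integral_of_dominated_loc_of_deriv_le (𝕜 := ℂ)
    (μ := MeasureTheory.volume) (a := 0) (b := 1) (x₀ := z₀)
    (F := fun z (u : ℝ) => f (u * z)) (F' := fun z (u : ℝ) => _root_.deriv f (u * z) * u)
    (bound := fun _ => C) (Metric.closedBall_mem_nhds z₀ hε) ?_ (hsegment z₀ hz₀ f hf.continuousOn)
    ?_ ?_ intervalIntegrable_const ?_
  · exact key.2.differentiableAt.differentiableWithinAt
  · filter_upwards [hD.mem_nhds hz₀] with z hz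
    exact (intervalIntegrable_iff.1 (hsegment z hz f hf.continuousOn)).aestronglyMeasurable
  · exact ((intervalIntegrable_iff.1 (hsegment z₀ hz₀ _ hd)).aestronglyMeasurable).mul
      (by fun_prop)
  · refine Eventually.of_forall fun u hu z hz => ?_
    rw [Set.uIoc_of_le zero_le_one] at hu
    have h1 := hC (u, z) ⟨⟨hu.1.le, hu.2⟩, hz⟩
    have h2 : ‖(u : ℂ)‖ ≤ 1 := by
      rw [Complex.norm_real, Real.norm_of_nonneg hu.1.le]; exact hu.2
    rw [norm_mul]
    exact (mul_le_of_le_one_right (norm_nonneg _) h2).trans h1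
  · refine Eventually.of_forall fun u hu z hz => ?_
    rw [Set.uIoc_of_le zero_le_one] at hu
    have h1 := (hf.differentiableAt
      (hD.mem_nhds (hstar z (hball hz) u ⟨hu.1.le, hu.2⟩))).hasDerivAt
    simpa [Function.comp_def] using h1.comp z ((hasDerivAt_id z).const_mul (u : ℂ))

/-- The function `Li_k(z) / z`, that is, the continuation of `∑ z ^ j / (j + 1) ^ k`. -/
def polylogQuotient : ℕ → ℂ → ℂ
  | 0, z => 1 / (1 - z)
  | k + 1, z => ∫ u in (0 : ℝ)..1, polylogQuotient k (u * z)

theorem differentiableOn_polylogQuotient (k : ℕ) :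
    DifferentiableOn ℂ (polylogQuotient k) polylogDomain := by
  induction k with
  | zero =>
    intro z hz
    exact ((differentiableAt_const 1).div (by fun_prop)
      (one_sub_ne_zero_of_mem_polylogDomain hz)).differentiableWithinAt
  | succ k ih =>
    exact ih.integral_comp_ofReal_mul isOpen_polylogDomain
      fun z hz u hu => ofReal_mul_mem_polylogDomain hz hu

/-- Averaging over `[0, z]` multiplies `z ^ j` by `∫ u ^ j = 1 / (j + 1)`; the geometric series in
`‖z‖` dominates. -/
theorem hasSum_polylogQuotient (k : ℕ) {z : ℂ} (hz : ‖z‖ < 1) :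
    HasSum (fun j : ℕ => z ^ j / ((j : ℂ) + 1) ^ k) (polylogQuotient k z) := by
  induction k generalizing z with
  | zero => simpa [polylogQuotient] using hasSum_geometric_of_norm_lt_one hz
  | succ k ih =>
    have hnorm : ∀ (j : ℕ) (u : ℝ), u ∈ Set.Icc (0 : ℝ) 1 → ‖(u : ℂ) * z‖ ≤ ‖z‖ := by
      intro j u hu
      rw [norm_mul, Complex.norm_real, Real.norm_of_nonneg hu.1]
      exact mul_le_of_le_one_left (norm_nonneg _) hu.2
    have h := intervalIntegral.hasSum_integral_of_dominated_convergence
      (μ := MeasureTheory.volume) (a := 0) (b := 1)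
      (F := fun (j : ℕ) (u : ℝ) => ((u : ℂ) * z) ^ j / ((j : ℂ) + 1) ^ k)
      (f := fun u : ℝ => polylogQuotient k (u * z)) (fun j _ => ‖z‖ ^ j) ?_ ?_ ?_ ?_ ?_
    · refine h.congr_fun ?_
      intro j
      have e : ∀ u : ℝ, ((u : ℂ) * z) ^ j / ((j : ℂ) + 1) ^ k
          = (u : ℂ) ^ j * (z ^ j / ((j : ℂ) + 1) ^ k) := fun u => by rw [mul_pow]; ring
      have h1 : ∫ u in (0 : ℝ)..1, (u : ℂ) ^ j = 1 / ((j : ℂ) + 1) := by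
        have := integral_pow (a := 0) (b := 1) j
        have h2 : ∫ u in (0 : ℝ)..1, (u : ℂ) ^ j = ((∫ u in (0 : ℝ)..1, u ^ j : ℝ) : ℂ) := by
          rw [← intervalIntegral.integral_ofReal]; simp
        rw [h2, this]; simp
      simp only [e]
      rw [intervalIntegral.integral_mul_const, h1, pow_succ]
      have : (j : ℂ) + 1 ≠ 0 := Nat.cast_add_one_ne_zero j
      field_simp
    · intro j; fun_prop
    · intro j
      refine Eventually.of_forall fun u hu => ?_
      rw [Set.uIoc_of_le zero_le_one] at hu
      have h2 : 1 ≤ ‖((j : ℂ) + 1) ^ k‖ := by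
        rw [norm_pow]
        refine one_le_pow₀ ?_
        have : ‖(j : ℂ) + 1‖ = (j : ℝ) + 1 := by exact_mod_cast Complex.norm_natCast (j + 1)
        rw [this]; simp
      rw [norm_div, norm_pow]
      exact (div_le_self (by positivity) h2).trans
        (pow_le_pow_left₀ (norm_nonneg _) (hnorm j u ⟨hu.1.le, hu.2⟩) j)
    · exact Eventually.of_forall fun u _ => summable_geometric_of_lt_one (norm_nonneg _) hz
    · exact intervalIntegrable_const
    · refine Eventually.of_forall fun u hu => ?_
      rw [Set.uIoc_of_le zero_le_one] at hu
      exact ih ((hnorm 0 u ⟨hu.1.le, hu.2⟩).trans_lt hz)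

/-- A decay estimate for `Li_k(z) / z` in a half-plane `Re z ≤ 1 - ρ`. -/
theorem exists_norm_polylogQuotient_le (k : ℕ) {ρ : ℝ} (hρ : 0 < ρ) (hρ1 : ρ ≤ 1) :
    ∃ C : ℝ, 0 ≤ C ∧ ∀ z : ℂ, ρ ≤ (1 - z).re →
      ‖polylogQuotient k z‖ ≤ C * (1 - z).re ^ (-(1 / 2) : ℝ) := by
  induction k with
  | zero =>
    refine ⟨ρ ^ (-(1 / 2) : ℝ), by positivity, fun z hz => ?_⟩
    have h0 : 0 < (1 - z).re := hρ.trans_le hz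
    have h1 : ‖polylogQuotient 0 z‖ ≤ (1 - z).re ^ (-1 : ℝ) := by
      rw [polylogQuotient, norm_div, norm_one, one_div, Real.rpow_neg_one]
      exact inv_anti₀ h0 (Complex.re_le_norm _)
    refine h1.trans ?_
    rw [show (-1 : ℝ) = -(1 / 2) + -(1 / 2) by norm_num, Real.rpow_add h0]
    gcongr ?_ * _
    exact Real.rpow_le_rpow_of_nonpos hρ hz (by norm_num)
  | succ k ih =>
    obtain ⟨C, hC0, hC⟩ := ih
    refine ⟨C * 2, by positivity, fun z hz => ?_⟩
    have h0 : 0 < (1 - z).re := hρ.trans_le hz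
    rw [polylogQuotient]
    -- The exponent `-1/2` survives the induction because `u ^ (-1/2)` is integrable at `0`; the
    -- true decay `1 / (1 - z)` at `k = 0` would not.
    have hint : ∫ u in (0 : ℝ)..1, u ^ (-(1 / 2) : ℝ) = 2 := by
      rw [integral_rpow (Or.inl (by norm_num))]; norm_num
    have hi : IntervalIntegrable (fun u : ℝ => u ^ (-(1 / 2) : ℝ) *
        (C * (1 - z).re ^ (-(1 / 2) : ℝ))) MeasureTheory.volume 0 1 :=
      (intervalIntegral.intervalIntegrable_rpow' (by norm_num)).mul_const _
    have h := intervalIntegral.norm_integral_le_of_norm_le zero_le_one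
      (f := fun u : ℝ => polylogQuotient k (u * z)) ?_ hi
    · rw [intervalIntegral.integral_mul_const, hint] at h
      linarith
    · refine Eventually.of_forall fun u hu => ?_
      -- This convex combination of `1` and `Re (1 - z)` is at least `ρ`, as `ρ ≤ 1`, and at least
      -- `u * Re (1 - z)`.
      have hre : (1 - (u : ℂ) * z).re = (1 - u) + u * (1 - z).re := by
        simp; ring
      have h1 : ρ ≤ (1 - (u : ℂ) * z).re := by
        rw [hre]; nlinarith [hu.1, hu.2]
      refine (hC _ h1).trans ?_
      rw [mul_left_comm, ← Real.mul_rpow hu.1.le h0.le]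
      gcongr C * ?_
      refine Real.rpow_le_rpow_of_nonpos (mul_pos hu.1 h0) ?_ (by norm_num)
      rw [hre]; linarith [hu.2]

end

/-! ### Mellin transforms of functions with decay in a half-strip. -/

noncomputable section

/-- The half-strip of width `2 δ` around `[-δ, ∞)`. -/
def halfStrip (δ : ℝ) : Set ℂ := {t | -δ < t.re ∧ |t.im| < δ}

/-- `h` is holomorphic and `O(e ^ (-Re t / 2))` in a half-strip around `[0, ∞)`. -/
def HasStripDecay (h : ℂ → ℂ) : Prop :=
  ∃ δ C : ℝ, 0 < δ ∧ DifferentiableOn ℂ h (halfStrip δ) ∧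
    ∀ t ∈ halfStrip δ, ‖h t‖ ≤ C * Real.exp (-t.re / 2)

theorem isOpen_halfStrip (δ : ℝ) : IsOpen (halfStrip δ) :=
  (isOpen_lt continuous_const Complex.continuous_re).inter
    (isOpen_lt Complex.continuous_im.abs continuous_const)

theorem halfStrip_mono {δ ε : ℝ} (h : δ ≤ ε) : halfStrip δ ⊆ halfStrip ε :=
  fun _ ht => ⟨by linarith [ht.1], by linarith [ht.2]⟩

theorem ofReal_mem_halfStrip {δ x : ℝ} (hδ : 0 < δ) (hx : 0 ≤ x) : (x : ℂ) ∈ halfStrip δ :=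
  ⟨by simp only [Complex.ofReal_re]; linarith, by simpa using hδ⟩

theorem closedBall_subset_halfStrip {δ : ℝ} {t : ℂ} (ht : t ∈ halfStrip (δ / 2)) :
    Metric.closedBall t (δ / 2) ⊆ halfStrip δ := by
  intro w hw
  rw [mem_closedBall_iff_norm] at hw
  have h1 := (abs_le.1 ((Complex.abs_re_le_norm (w - t)).trans hw)).1
  have h2 := (Complex.abs_im_le_norm (w - t)).trans hw
  rw [Complex.sub_re] at h1
  rw [Complex.sub_im] at h2
  refine ⟨by linarith [ht.1], ?_⟩
  have h3 := abs_add_le (w.im - t.im) t.im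
  rw [sub_add_cancel] at h3
  linarith [ht.2]

namespace HasStripDecay

variable {h g : ℂ → ℂ}

/-- Cauchy's estimate on discs of radius `δ / 2`, over which `e^{-Re t/2}` grows by a factor of at
most `e^{δ/4}`. -/
protected theorem deriv (hh : HasStripDecay h) : HasStripDecay (deriv h) := by
  obtain ⟨δ, C, hδ, hd, hC⟩ := hh
  refine ⟨δ / 2, C * Real.exp (δ / 4) / (δ / 2), by positivity,
    (hd.deriv (isOpen_halfStrip δ)).mono (halfStrip_mono (by linarith)), fun t ht => ?_⟩
  have hsub := closedBall_subset_halfStrip ht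
  have hC0 : 0 ≤ C := nonneg_of_mul_nonneg_left ((norm_nonneg _).trans (hC t
    (hsub (Metric.mem_closedBall_self (by positivity))))) (Real.exp_pos _)
  have := Complex.norm_deriv_le_of_forall_mem_sphere_norm_le (c := t) (R := δ / 2)
    (C := C * Real.exp (δ / 4) * Real.exp (-t.re / 2)) (f := h) (by positivity)
    (hd.diffContOnCl_ball hsub) ?_
  · refine this.trans (le_of_eq ?_); ring
  · intro w hw
    refine (hC w (hsub (Metric.sphere_subset_closedBall hw))).trans ?_
    rw [mul_assoc, ← Real.exp_add]
    gcongr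
    have h1 := (abs_le.1 ((Complex.abs_re_le_norm (w - t)).trans
      (mem_closedBall_iff_norm.1 (Metric.sphere_subset_closedBall hw)))).1
    rw [Complex.sub_re] at h1
    linarith

protected theorem add (hh : HasStripDecay h) (hg : HasStripDecay g) :
    HasStripDecay (fun t => h t + g t) := by
  obtain ⟨δ, C, hδ, hd, hC⟩ := hh
  obtain ⟨δ', C', hδ', hd', hC'⟩ := hg
  have h1 := halfStrip_mono (min_le_left δ δ')
  have h2 := halfStrip_mono (min_le_right δ δ')
  refine ⟨min δ δ', C + C', lt_min hδ hδ', (hd.mono h1).add (hd'.mono h2), fun t ht => ?_⟩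
  rw [add_mul]
  exact norm_add_le_of_le (hC t (h1 ht)) (hC' t (h2 ht))

theorem one_sub_exp_neg_mul (hh : HasStripDecay h) :
    HasStripDecay (fun t => (1 - Complex.exp (-t)) * h t) := by
  obtain ⟨δ, C, hδ, hd, hC⟩ := hh
  refine ⟨δ, (1 + Real.exp δ) * C, hδ, DifferentiableOn.mul (by fun_prop) hd, fun t ht => ?_⟩
  rw [norm_mul, mul_assoc]
  refine mul_le_mul ?_ (hC t ht) (norm_nonneg _) (by positivity)
  refine (norm_sub_le _ _).trans ?_
  rw [norm_one, Complex.norm_exp, Complex.neg_re]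
  gcongr
  linarith [ht.1]

theorem congr (hh : HasStripDecay h) {δ : ℝ} (hδ : 0 < δ) (he : Set.EqOn g h (halfStrip δ)) :
    HasStripDecay g := by
  obtain ⟨ε, C, hε, hd, hC⟩ := hh
  have h1 := halfStrip_mono (min_le_left δ ε)
  have h2 := halfStrip_mono (min_le_right δ ε)
  refine ⟨min δ ε, C, lt_min hδ hε, (hd.mono h2).congr fun t ht => he (h1 ht), fun t ht => ?_⟩
  rw [he (h1 ht)]
  exact hC t (h2 ht)

theorem iteratedDeriv (hh : HasStripDecay h) (N : ℕ) : HasStripDecay (iteratedDeriv N h) := by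
  induction N with
  | zero => simpa using hh
  | succ N ih => rw [iteratedDeriv_succ]; exact ih.deriv

theorem differentiableAt_ofReal (hh : HasStripDecay h) {x : ℝ} (hx : 0 ≤ x) :
    DifferentiableAt ℂ h x := by
  obtain ⟨δ, C, hδ, hd, hC⟩ := hh
  exact hd.differentiableAt ((isOpen_halfStrip δ).mem_nhds (ofReal_mem_halfStrip hδ hx))

theorem continuousOn_ofReal (hh : HasStripDecay h) :
    ContinuousOn (fun x : ℝ => h x) (Set.Ici 0) := fun _ hx =>
  ((hh.differentiableAt_ofReal hx).continuousAt.comp (f := fun x : ℝ => (x : ℂ))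
    Complex.continuous_ofReal.continuousAt).continuousWithinAt

theorem locallyIntegrableOn (hh : HasStripDecay h) :
    MeasureTheory.LocallyIntegrableOn (fun x : ℝ => h x) (Set.Ioi 0) :=
  (hh.continuousOn_ofReal.mono Set.Ioi_subset_Ici_self).locallyIntegrableOn measurableSet_Ioi

theorem isBigO_atTop (hh : HasStripDecay h) :
    (fun x : ℝ => h x) =O[atTop] fun x : ℝ => Real.exp (-(1 / 2) * x) := by
  obtain ⟨δ, C, hδ, hd, hC⟩ := hh
  refine Asymptotics.IsBigO.of_bound C ?_
  filter_upwards [eventually_ge_atTop 0] with x hx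
  rw [Real.norm_of_nonneg (Real.exp_pos _).le]
  refine (hC x (ofReal_mem_halfStrip hδ hx)).trans (le_of_eq ?_)
  rw [Complex.ofReal_re]; ring_nf

theorem tendsto_nhdsGT_zero (hh : HasStripDecay h) :
    Tendsto (fun x : ℝ => h x) (𝓝[>] 0) (𝓝 (h 0)) := by
  simpa using (hh.continuousOn_ofReal 0 Set.self_mem_Ici).mono_left
    (nhdsWithin_mono _ Set.Ioi_subset_Ici_self)

theorem isBigO_nhdsGT_zero (hh : HasStripDecay h) :
    (fun x : ℝ => h x) =O[𝓝[>] 0] fun x : ℝ => x ^ (-(0 : ℝ)) := by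
  simpa using hh.tendsto_nhdsGT_zero.isBigO_one ℝ

theorem mellinConvergent (hh : HasStripDecay h) {s : ℂ} (hs : 0 < s.re) :
    MellinConvergent (fun x : ℝ => h x) s :=
  mellinConvergent_of_isBigO_rpow_exp one_half_pos hh.locallyIntegrableOn hh.isBigO_atTop
    hh.isBigO_nhdsGT_zero hs

theorem differentiableAt_mellin (hh : HasStripDecay h) {s : ℂ} (hs : 0 < s.re) :
    DifferentiableAt ℂ (mellin fun x : ℝ => h x) s :=
  mellin_differentiableAt_of_isBigO_rpow_exp one_half_pos hh.locallyIntegrableOn hh.isBigO_atTop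
    hh.isBigO_nhdsGT_zero hs

theorem hasDerivAt_ofReal (hh : HasStripDecay h) {x : ℝ} (hx : 0 ≤ x) :
    HasDerivAt (fun y : ℝ => h y) (_root_.deriv h x) x :=
  (hh.differentiableAt_ofReal hx).hasDerivAt.comp_ofReal

theorem tendsto_cpow_mul_atTop (hh : HasStripDecay h) (s : ℂ) :
    Tendsto (fun x : ℝ => (x : ℂ) ^ s * h x) atTop (𝓝 0) := by
  rw [tendsto_zero_iff_norm_tendsto_zero]
  have h1 : (fun x : ℝ => (x : ℂ) ^ s * h x) =O[atTop]
      fun x : ℝ => x ^ s.re * Real.exp (-(1 / 2) * x) := by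
    refine Asymptotics.IsBigO.mul ?_ hh.isBigO_atTop
    refine Asymptotics.IsBigO.of_bound 1 ?_
    filter_upwards [eventually_gt_atTop 0] with x hx
    rw [Complex.norm_cpow_eq_rpow_re_of_pos hx, one_mul]
    exact Real.le_norm_self _
  exact (h1.trans_tendsto (tendsto_rpow_mul_exp_neg_mul_atTop_nhds_zero _ _ one_half_pos)).norm
    |>.trans (by simp)

/-- Integration by parts: the boundary term vanishes at `0` because `Re s > 0`, and at infinity by
exponential decay. -/
theorem mellin_deriv (hh : HasStripDecay h) {s : ℂ} (hs : 0 < s.re) :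
    mellin (fun x : ℝ => _root_.deriv h x) (s + 1) = -s * mellin (fun x : ℝ => h x) s := by
  have hs0 : s ≠ 0 := fun h0 => by simp [h0] at hs
  have h0 : Tendsto (fun x : ℝ => (x : ℂ) ^ s * h x) (𝓝[>] 0) (𝓝 0) := by
    have h1 : Tendsto (fun x : ℝ => (x : ℂ) ^ s) (𝓝[>] 0) (𝓝 0) := by
      have := (Complex.continuousAt_ofReal_cpow_const 0 s (Or.inl hs)).tendsto
      simp only [Complex.ofReal_zero, Complex.zero_cpow hs0] at this
      exact this.mono_left nhdsWithin_le_nhds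
    simpa using h1.mul hh.tendsto_nhdsGT_zero
  have key := MeasureTheory.integral_Ioi_mul_deriv_eq_deriv_mul (a := 0)
    (u := fun x : ℝ => (x : ℂ) ^ s) (u' := fun x : ℝ => s * (x : ℂ) ^ (s - 1))
    (v := fun x : ℝ => h x) (v' := fun x : ℝ => _root_.deriv h x) (a' := 0) (b' := 0)
    ?_ (fun x hx => hh.hasDerivAt_ofReal (le_of_lt hx)) ?_ ?_ h0 (hh.tendsto_cpow_mul_atTop s)
  · simp only [mellin, smul_eq_mul, add_sub_cancel_right]
    rw [key]
    simp only [mul_assoc]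
    rw [MeasureTheory.integral_const_mul]
    ring
  · intro x hx
    exact hasDerivAt_ofReal_cpow_const (ne_of_gt hx) hs0
  · have := hh.deriv.mellinConvergent (s := s + 1) (by simp; linarith)
    simpa [MellinConvergent, Pi.mul_def] using this
  · have := (hh.mellinConvergent hs).const_mul s
    simpa [MellinConvergent, mul_assoc, Pi.mul_def, MeasureTheory.IntegrableOn] using this

/-- The limiting case `s = 0` of `mellin_deriv`, where the boundary term at `0` survives. -/
theorem integral_deriv (hh : HasStripDecay h) :
    ∫ x in Set.Ioi (0 : ℝ), _root_.deriv h x = -h 0 := by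
  have hi := hh.deriv.mellinConvergent (s := 1) (by simp)
  have := MeasureTheory.integral_Ioi_of_hasDerivAt_of_tendsto' (a := 0) (m := 0)
    (f := fun x : ℝ => h x) (f' := fun x : ℝ => _root_.deriv h x)
    (fun x hx => hh.hasDerivAt_ofReal hx) (by simpa [MellinConvergent] using hi)
    (by simpa using hh.tendsto_cpow_mul_atTop 0)
  simpa using this

end HasStripDecay

/-- The integral `Γ(s + N)⁻¹ ∫_0^∞ t ^ (s + N - 1) (-1) ^ N h⁽ᴺ⁾(t) dt`, which continues
`Γ(s)⁻¹ ∫_0^∞ t ^ (s - 1) h(t) dt` to `-N < Re s`. -/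
def gammaMellin (h : ℂ → ℂ) (N : ℕ) (s : ℂ) : ℂ :=
  (-1) ^ N * (Complex.Gamma (s + N))⁻¹ * mellin (fun x : ℝ => iteratedDeriv N h x) (s + N)

/-- The entire function that continues `Γ(s)⁻¹ ∫_0^∞ t ^ (s - 1) h(t) dt`. -/
def gammaMellinContinuation (h : ℂ → ℂ) (s : ℂ) : ℂ :=
  gammaMellin h (⌊-s.re⌋₊ + 1) s

namespace HasStripDecay

variable {h : ℂ → ℂ}

/-- The factor `-(s + N)` from `mellin_deriv` cancels against `Γ(s + N + 1) = (s + N) Γ(s + N)` and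
the sign. -/
theorem gammaMellin_succ (hh : HasStripDecay h) {N : ℕ} {s : ℂ} (hs : -(N : ℝ) < s.re) :
    gammaMellin h (N + 1) s = gammaMellin h N s := by
  have hs' : 0 < (s + N).re := by simp; linarith
  have h0 : s + N ≠ 0 := fun h0 => by simp [h0] at hs'
  have hm := (hh.iteratedDeriv N).mellin_deriv hs'
  rw [gammaMellin, gammaMellin, iteratedDeriv_succ, Nat.cast_succ, ← add_assoc, hm,
    Complex.Gamma_add_one _ h0, pow_succ]
  field_simp

theorem gammaMellin_add (hh : HasStripDecay h) {N : ℕ} (j : ℕ) {s : ℂ} (hs : -(N : ℝ) < s.re) :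
    gammaMellin h (N + j) s = gammaMellin h N s := by
  induction j with
  | zero => rfl
  | succ j ih =>
    rw [← ih, ← add_assoc]
    exact hh.gammaMellin_succ (by push_cast; linarith [(Nat.cast_nonneg j : (0 : ℝ) ≤ j)])

/-- Independence of `N` removes the jumps of the floor: near any point one fixed `N` serves, whence
holomorphy. -/
theorem gammaMellinContinuation_eq (hh : HasStripDecay h) {N : ℕ} {s : ℂ}
    (hs : -(N : ℝ) < s.re) : gammaMellinContinuation h s = gammaMellin h N s := by
  have h1 : -((⌊-s.re⌋₊ + 1 : ℕ) : ℝ) < s.re := by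
    have := Nat.lt_floor_add_one (-s.re)
    push_cast; linarith
  rw [gammaMellinContinuation, ← hh.gammaMellin_add N h1, add_comm, hh.gammaMellin_add _ hs]

theorem differentiable_gammaMellinContinuation (hh : HasStripDecay h) :
    Differentiable ℂ (gammaMellinContinuation h) := by
  intro s
  obtain ⟨N, hN⟩ := exists_nat_gt (-s.re)
  have hs : -(N : ℝ) < s.re := by linarith
  have hd : DifferentiableAt ℂ (gammaMellin h N) s := by
    have hm := (hh.iteratedDeriv N).differentiableAt_mellin (s := s + N) (by simp; linarith)
    exact ((differentiableAt_const _).mul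
      ((Complex.differentiable_one_div_Gamma _).comp s (by fun_prop))).mul
      (DifferentiableAt.comp (g := mellin fun x : ℝ => _root_.iteratedDeriv N h x)
        (f := fun s : ℂ => s + N) s hm (by fun_prop))
  refine hd.congr_of_eventuallyEq ?_
  filter_upwards [(isOpen_lt continuous_const Complex.continuous_re).mem_nhds hs] with w hw
  exact hh.gammaMellinContinuation_eq hw

theorem gammaMellinContinuation_of_re_pos (hh : HasStripDecay h) {s : ℂ} (hs : 0 < s.re) :
    gammaMellinContinuation h s = (Complex.Gamma s)⁻¹ * mellin (fun x : ℝ => h x) s := by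
  rw [hh.gammaMellinContinuation_eq (N := 0) (by simpa using hs)]
  simp [gammaMellin]

theorem gammaMellinContinuation_neg_natCast (hh : HasStripDecay h) (m : ℕ) :
    gammaMellinContinuation h (-(m : ℂ)) = (-1) ^ m * _root_.iteratedDeriv m h 0 := by
  rw [hh.gammaMellinContinuation_eq (N := m + 1) (by simp)]
  -- With `N = m + 1` both the Gamma factor and the power of `t` become `1`.
  have h1 : -(m : ℂ) + (m + 1 : ℕ) = 1 := by push_cast; ring
  have h2 := (hh.iteratedDeriv m).integral_deriv
  rw [gammaMellin, h1, iteratedDeriv_succ, mellin]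
  simp [h2, pow_succ]

end HasStripDecay

end

/-! ### The double polylogarithm and the kernel of `η`. -/

noncomputable section

/-- The function `Li_{k,-n}(z) / z`. -/
def doublePolylogQuotient (k : ℕ) : ℕ → ℂ → ℂ
  | 0, z => z * polylogQuotient k z / (1 - z)
  | n + 1, z => doublePolylogQuotient k n z + z * deriv (doublePolylogQuotient k n) z

theorem differentiableOn_doublePolylogQuotient (k n : ℕ) :
    DifferentiableOn ℂ (doublePolylogQuotient k n) polylogDomain := by
  induction n with
  | zero =>
    exact (differentiableOn_id.mul (differentiableOn_polylogQuotient k)).div (by fun_prop)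
      fun z hz => one_sub_ne_zero_of_mem_polylogDomain hz
  | succ n ih => exact ih.add (differentiableOn_id.mul (ih.deriv isOpen_polylogDomain))

theorem doublePolylogQuotient_zero_right (k n : ℕ) : doublePolylogQuotient k n 0 = 0 := by
  induction n with
  | zero => simp [doublePolylogQuotient]
  | succ n ih => simp [doublePolylogQuotient, ih]

/-- The pairs `0 < m₁ < m₂` correspond to the pairs `(m₁ - 1, m₂ - m₁ - 1)`. -/
def polylogIndexEquiv : ℕ × ℕ ≃ PolylogIndex where
  toFun q := ⟨(q.1 + 1, q.1 + q.2 + 2), by dsimp only; omega⟩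
  invFun p := (p.1.1 - 1, p.1.2 - p.1.1 - 1)
  left_inv q := by ext <;> dsimp only <;> omega
  right_inv p := by
    have := p.2
    refine Subtype.ext (Prod.ext ?_ ?_) <;> dsimp only <;> omega

theorem HasSum.prodMul {f g : ℕ → ℂ} {s t : ℂ} (hf : HasSum f s) (hg : HasSum g t) :
    HasSum (fun q : ℕ × ℕ => f q.1 * g q.2) (s * t) :=
  hf.mul hg (summable_mul_of_summable_norm hf.summable.norm hg.summable.norm)

/-- Since `z ^ m₂ = z ^ m₁ * z ^ (m₂ - m₁)`, the double series is the product of the series of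
`Li_k` and a geometric series. -/
theorem hasSum_doublePolylogTerm_zero (k : ℕ) {z : ℂ} (hz : ‖z‖ < 1) :
    HasSum (doublePolylogTerm k 0 z) (z * (z * polylogQuotient k z / (1 - z))) := by
  rw [← polylogIndexEquiv.hasSum_iff]
  have h1 : HasSum (fun i : ℕ => z * (z ^ i / ((i : ℂ) + 1) ^ k)) (z * polylogQuotient k z) :=
    (hasSum_polylogQuotient k hz).mul_left z
  have h2 : HasSum (fun j : ℕ => z * z ^ j) (z * (1 - z)⁻¹) :=
    (hasSum_geometric_of_norm_lt_one hz).mul_left z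
  have h3 := h1.prodMul h2
  rw [show z * polylogQuotient k z * (z * (1 - z)⁻¹) = z * (z * polylogQuotient k z / (1 - z)) by
    ring] at h3
  refine h3.congr_fun fun q => ?_
  have hq : (polylogIndexEquiv q).1 = (q.1 + 1, q.1 + q.2 + 2) := rfl
  rw [Function.comp_apply, doublePolylogTerm, hq, zpow_natCast, zpow_zero, mul_one]
  push_cast
  ring

theorem differentiable_doublePolylogTerm (a b : ℤ) (p : PolylogIndex) :
    Differentiable ℂ fun z => doublePolylogTerm a b z p := by
  unfold doublePolylogTerm
  fun_prop

theorem doublePolylogTerm_sub_one (a b : ℤ) (z : ℂ) (p : PolylogIndex) :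
    doublePolylogTerm a (b - 1) z p = z * deriv (fun w => doublePolylogTerm a b w p) z := by
  have h0 : (p.1.2 : ℂ) ≠ 0 := by have := p.2; exact_mod_cast (by omega : p.1.2 ≠ 0)
  have hp : p.1.2 = (p.1.2 - 1) + 1 := by have := p.2; omega
  simp only [doublePolylogTerm, deriv_div_const, deriv_pow_field]
  rw [zpow_sub_one₀ h0]
  have : z ^ p.1.2 = z * z ^ (p.1.2 - 1) := by conv_lhs => rw [hp, pow_succ']
  rw [this]
  field_simp

/-- The Euler operator `z d/dz` lowers the second index of the double polylogarithm. -/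
theorem IsDoublePolylog.mul_deriv {a b : ℤ} {f : ℂ → ℂ} (hf : IsDoublePolylog a b f) :
    IsDoublePolylog a (b - 1) fun z => z * deriv f z := by
  refine ⟨differentiableOn_id.mul (hf.1.deriv isOpen_polylogDomain), fun z hz => ?_⟩
  obtain ⟨r, hzr, hr⟩ := exists_between hz
  have hr0 : 0 ≤ r := (norm_nonneg z).trans hzr.le
  -- The series at the real point `r`, with `‖z‖ < r < 1`, is the majorant for termwise
  -- differentiation on the disc of radius `r`.
  have hu := (hf.2 r (by rwa [Complex.norm_real, Real.norm_of_nonneg hr0])).summable.norm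
  have hzU : z ∈ Metric.ball (0 : ℂ) r := by simpa using hzr
  have h := Complex.hasSum_deriv_of_summable_norm (F := fun p w => doublePolylogTerm a b w p) hu
    (fun p => (differentiable_doublePolylogTerm a b p).differentiableOn) Metric.isOpen_ball
    (fun p w hw => ?_) hzU
  · have he : (fun w => ∑' p, doublePolylogTerm a b w p) =ᶠ[𝓝 z] f := by
      filter_upwards [Metric.isOpen_ball.mem_nhds hzU] with w hw
      exact (hf.2 w ((by simpa using hw : ‖w‖ < r).trans hr)).tsum_eq
    rw [he.deriv_eq] at h
    simpa only [← doublePolylogTerm_sub_one] using h.mul_left z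
  · have hw' : ‖w‖ ≤ ‖(r : ℂ)‖ := by
      rw [Complex.norm_real, Real.norm_of_nonneg hr0]
      exact (by simpa using hw : ‖w‖ < r).le
    simp only [doublePolylogTerm, norm_div, norm_pow]
    gcongr

theorem isDoublePolylog_mul_doublePolylogQuotient (k n : ℕ) :
    IsDoublePolylog k (-(n : ℤ)) fun z => z * doublePolylogQuotient k n z := by
  induction n with
  | zero =>
    refine ⟨differentiableOn_id.mul (differentiableOn_doublePolylogQuotient k 0), fun z hz => ?_⟩
    simpa [doublePolylogQuotient] using hasSum_doublePolylogTerm_zero k hz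
  | succ n ih =>
    have h := ih.mul_deriv
    rw [show -((n + 1 : ℕ) : ℤ) = -(n : ℤ) - 1 by push_cast; ring]
    have he : ∀ z ∈ polylogDomain, z * doublePolylogQuotient k (n + 1) z
        = z * deriv (fun z => z * doublePolylogQuotient k n z) z := by
      intro z hz
      have hd := (differentiableOn_doublePolylogQuotient k n).differentiableAt
        (isOpen_polylogDomain.mem_nhds hz)
      rw [deriv_fun_mul differentiableAt_fun_id hd, deriv_id'', doublePolylogQuotient, one_mul]
    refine ⟨h.1.congr he, fun z hz => ?_⟩
    beta_reduce
    rw [he z (mem_polylogDomain_of_norm_lt_one hz)]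
    exact h.2 z hz

theorem isDoublePolylog_doublePolylog (k n : ℕ) :
    IsDoublePolylog k (-(n : ℤ)) (doublePolylog k (-(n : ℤ))) :=
  Classical.epsilon_spec ⟨_, isDoublePolylog_mul_doublePolylogQuotient k n⟩

theorem doublePolylog_div_self (k n : ℕ) {z : ℂ} (hz : z ∈ polylogDomain) :
    doublePolylog k (-(n : ℤ)) z / z = doublePolylogQuotient k n z := by
  rw [(isDoublePolylog_doublePolylog k n).eqOn
    (isDoublePolylog_mul_doublePolylogQuotient k n) hz]
  rcases eq_or_ne z 0 with rfl | h0
  · simp [doublePolylogQuotient_zero_right]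
  · exact mul_div_cancel_left₀ _ h0

/-- The continuation of the kernel of `η(k, -n; s)` to complex `t`. -/
def etaKernelExtension (k n : ℕ) (t : ℂ) : ℂ :=
  doublePolylogQuotient k n (1 - Complex.exp t)

/-- With `1 - z = e^t`, this keeps `z` off the cut and turns decay in `Re (1 - z)` into decay in
`e^{Re t}`. -/
theorem cos_one_mul_exp_le_re_exp {t : ℂ} (ht : |t.im| ≤ 1) :
    Real.cos 1 * Real.exp t.re ≤ (Complex.exp t).re := by
  rw [Complex.exp_re, mul_comm]
  gcongr
  rw [← Real.cos_abs t.im]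
  exact Real.cos_le_cos_of_nonneg_of_le_pi (abs_nonneg _) (by linarith [Real.pi_gt_three]) ht

theorem one_sub_exp_mem_polylogDomain {t : ℂ} (ht : |t.im| ≤ 1) :
    1 - Complex.exp t ∈ polylogDomain := by
  refine Or.inl ?_
  rw [sub_sub_cancel]
  exact (mul_pos Real.cos_one_pos (Real.exp_pos _)).trans_le (cos_one_mul_exp_le_re_exp ht)

/-- For `z = 1 - e^t` the chain rule turns `z d/dz` into `(1 - e^{-t}) d/dt`. -/
theorem etaKernelExtension_succ (k n : ℕ) {t : ℂ} (ht : |t.im| ≤ 1) :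
    etaKernelExtension k (n + 1) t = etaKernelExtension k n t
      + (1 - Complex.exp (-t)) * deriv (etaKernelExtension k n) t := by
  have hd := ((differentiableOn_doublePolylogQuotient k n).differentiableAt
    (isOpen_polylogDomain.mem_nhds (one_sub_exp_mem_polylogDomain ht))).hasDerivAt
  have h1 := hd.comp t ((Complex.hasDerivAt_exp t).const_sub 1)
  have h2 : deriv (etaKernelExtension k n) t = _ := h1.deriv
  rw [h2, etaKernelExtension, doublePolylogQuotient, etaKernelExtension, Complex.exp_neg]
  have := Complex.exp_ne_zero t
  field_simp
  ring

theorem hasStripDecay_etaKernelExtension_zero (k : ℕ) :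
    HasStripDecay (etaKernelExtension k 0) := by
  have hc := Real.cos_one_pos
  -- A lower bound for `Re e^t` on the half-strip with `δ = 1`.
  have hρ : 0 < Real.cos 1 * Real.exp (-1) := by positivity
  have hρ1 : Real.cos 1 * Real.exp (-1) ≤ 1 :=
    mul_le_one₀ (Real.cos_le_one 1) (Real.exp_pos _).le (Real.exp_le_one_iff.2 (by norm_num))
  obtain ⟨C, hC0, hC⟩ := exists_norm_polylogQuotient_le k hρ hρ1
  refine ⟨1, (1 + Real.exp 1) * (C * Real.cos 1 ^ (-(1 / 2) : ℝ)), one_pos, ?_, fun t ht => ?_⟩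
  · exact (differentiableOn_doublePolylogQuotient k 0).comp
      (f := fun t => 1 - Complex.exp t) (by fun_prop)
      fun t ht => one_sub_exp_mem_polylogDomain ht.2.le
  · have hre := cos_one_mul_exp_le_re_exp ht.2.le
    have h1 := hC (1 - Complex.exp t) (by
      rw [sub_sub_cancel]
      refine le_trans ?_ hre
      gcongr
      exact ht.1.le)
    rw [sub_sub_cancel] at h1
    have h2 : ‖polylogQuotient k (1 - Complex.exp t)‖
        ≤ C * Real.cos 1 ^ (-(1 / 2) : ℝ) * Real.exp (-t.re / 2) := by
      refine h1.trans ?_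
      rw [mul_assoc]
      gcongr C * ?_
      refine (Real.rpow_le_rpow_of_nonpos (by positivity) hre (by norm_num)).trans (le_of_eq ?_)
      rw [Real.mul_rpow hc.le (Real.exp_pos _).le, ← Real.exp_mul]
      ring_nf
    -- The factor `z / (1 - z)` is `e^{-t} - 1`, bounded since `Re t > -1`; all decay comes from
    -- `polylogQuotient`.
    have h3 : ‖(1 - Complex.exp t) / Complex.exp t‖ ≤ 1 + Real.exp 1 := by
      rw [sub_div, div_self (Complex.exp_ne_zero t), one_div, ← Complex.exp_neg]
      refine (norm_sub_le _ _).trans ?_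
      rw [norm_one, Complex.norm_exp, Complex.neg_re, add_comm]
      gcongr
      linarith [ht.1]
    rw [etaKernelExtension, doublePolylogQuotient, sub_sub_cancel, mul_div_right_comm, norm_mul,
      mul_assoc (1 + Real.exp 1)]
    exact mul_le_mul h3 h2 (norm_nonneg _) (by positivity)

theorem hasStripDecay_etaKernelExtension (k n : ℕ) : HasStripDecay (etaKernelExtension k n) := by
  induction n with
  | zero => exact hasStripDecay_etaKernelExtension_zero k
  | succ n ih =>
    exact (ih.add ih.deriv.one_sub_exp_neg_mul).congr one_pos
      fun t ht => etaKernelExtension_succ k n ht.2.le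

theorem etaKernel_eq_etaKernelExtension (k n : ℕ) (t : ℝ) :
    etaKernel k (-(n : ℤ)) t = etaKernelExtension k n t :=
  doublePolylog_div_self k n (one_sub_exp_mem_polylogDomain (by simp))

theorem polyBernoulliGen_eq_etaKernelExtension (k n : ℕ) {t : ℂ} (ht : |t.im| ≤ 1) :
    polyBernoulliGen k (-(n : ℤ)) t = etaKernelExtension k n (-t) :=
  doublePolylog_div_self k n (one_sub_exp_mem_polylogDomain (by simpa using ht))

theorem ball_zero_one_abs_im_le {t : ℂ} (ht : t ∈ Metric.ball (0 : ℂ) 1) : |t.im| ≤ 1 :=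
  (Complex.abs_im_le_norm t).trans (by simpa using ht : ‖t‖ < 1).le

theorem differentiableOn_polyBernoulliGen (k n : ℕ) :
    DifferentiableOn ℂ (polyBernoulliGen k (-(n : ℤ))) (Metric.ball 0 1) := by
  have h : DifferentiableOn ℂ (fun t => etaKernelExtension k n (-t)) (Metric.ball 0 1) :=
    (differentiableOn_doublePolylogQuotient k n).comp (f := fun t => 1 - Complex.exp (-t))
      (by fun_prop) fun t ht =>
        one_sub_exp_mem_polylogDomain (by simpa using ball_zero_one_abs_im_le ht)
  exact h.congr fun t ht =>
    polyBernoulliGen_eq_etaKernelExtension k n (ball_zero_one_abs_im_le ht)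

theorem multiPolyBernoulli_eq_iteratedDeriv (k n m : ℕ) :
    multiPolyBernoulli k (-(n : ℤ)) m = (-1) ^ m * iteratedDeriv m (etaKernelExtension k n) 0 := by
  have he : polyBernoulliGen k (-(n : ℤ)) =ᶠ[𝓝 0] fun t => etaKernelExtension k n (-t) := by
    filter_upwards [Metric.ball_mem_nhds (0 : ℂ) one_pos] with t ht
    exact polyBernoulliGen_eq_etaKernelExtension k n (ball_zero_one_abs_im_le ht)
  rw [multiPolyBernoulli, he.iteratedDeriv_eq, iteratedDeriv_comp_neg, neg_zero, smul_eq_mul]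

end

theorem mainTheorem6 (k n : ℕ) (hk : 1 ≤ k) :
    -- the double polylogarithm exists on the cut plane
    IsDoublePolylog (k : ℤ) (-(n : ℤ)) (doublePolylog (k : ℤ) (-(n : ℤ))) ∧
    -- the numbers are the ones defined by the generating function
    (∀ᶠ t in 𝓝[≠] (0 : ℂ),
      HasSum (fun m : ℕ => multiPolyBernoulli (k : ℤ) (-(n : ℤ)) m * t ^ m / (m.factorial : ℂ))
        (doublePolylog (k : ℤ) (-(n : ℤ)) (1 - Complex.exp (-t)) / (1 - Complex.exp (-t)))) ∧
    -- the defining integral converges absolutely for positive real part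
    (∀ s : ℂ, 0 < s.re →
      MeasureTheory.IntegrableOn
        (fun t : ℝ => (t : ℂ) ^ (s - 1) * etaKernel (k : ℤ) (-(n : ℤ)) t) (Set.Ioi 0)) ∧
    -- entire continuation and its values at the nonpositive integers
    ∃ F : ℂ → ℂ, Differentiable ℂ F ∧
      (∀ s : ℂ, 0 < s.re → F s = etaFunction (k : ℤ) (-(n : ℤ)) s) ∧
      ∀ m : ℕ, F (-(m : ℂ)) = multiPolyBernoulli (k : ℤ) (-(n : ℤ)) m := by
  have hdecay := hasStripDecay_etaKernelExtension k n
  refine ⟨isDoublePolylog_doublePolylog k n, ?_, fun s hs => ?_,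
    gammaMellinContinuation (etaKernelExtension k n),
    hdecay.differentiable_gammaMellinContinuation, fun s hs => ?_, fun m => ?_⟩
  · filter_upwards [mem_nhdsWithin_of_mem_nhds (Metric.ball_mem_nhds (0 : ℂ) one_pos)] with t ht
    refine (Complex.hasSum_taylorSeries_on_ball (differentiableOn_polyBernoulliGen k n)
      ht).congr_fun fun m => ?_
    rw [multiPolyBernoulli, sub_zero, smul_eq_mul, smul_eq_mul]
    ring
  · simp only [etaKernel_eq_etaKernelExtension]
    exact hdecay.mellinConvergent hs
  · rw [hdecay.gammaMellinContinuation_of_re_pos hs, etaFunction, mellin, one_div]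
    simp only [etaKernel_eq_etaKernelExtension, smul_eq_mul]
  · rw [hdecay.gammaMellinContinuation_neg_natCast, multiPolyBernoulli_eq_iteratedDeriv]
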